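/- Let $n\ge 1$, let $N$ be a set of $n$ agents and $O$ a set of $n$ objects. For each $i\in N$ let $\mathcal R_i$ be the set of all strict (i.e. total, transitive, antisymmetric) preference orderings $R_i$ of $O$, with strict part $P_i$, and let $\mathcal R=\prod_{i\in N}\mathcal R_i$. An assignment is a bijection $\mu:N\to O$, $i\mapsto\mu_i$, and an assignment rule is a map $\phi$ from $\mathcal R$ to the set of assignments; write $\phi_i(R)$ for the object assigned to $i$ at $R$. The rule $\phi$ is efficient if for no $R\in\mathcal R$ there is an assignment $\nu$ with $\nu_i\,R_i\,\phi_i(R)$ for all $i\in N$ and $\nu_j\,P_j\,\phi_j(R)$ for some $j\in N$. It is group-strategy-proof if there are no $R\in\mathcal R$, $G\subseteq N$ and $R'_G\in\prod_{i\in G}\mathcal R_i$ such that $\phi_i(R'_G,R_{-G})\,R_i\,\phi_i(R)$ for all $i\in G$ and $\phi_j(R'_G,R_{-G})\,P_j\,\phi_j(R)$ for some $j\in G$. The cardinal index of freedom of agent $i$ given the others' preferences $R_{-i}$ is the size of $i$'s menu, $$\Delta_{i|i}^\phi(R_{-i})=\bigl|\{\phi_i(R_i',R_{-i}) : R_i'\in\mathcal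 R_i\}\bigr|.$$ Let $\phi$ be an efficient and group-strategy-proof assignment rule, and suppose that the preferences $R_i$, $i\in N$, are drawn independently, each $R_i$ uniformly from $\mathcal R_i$. Then the average expected cardinal index of freedom is $$\mathbb E\Bigl[\frac1n\sum_{i\in N}\Delta_{i|i}^\phi(R_{-i})\Bigr]=\frac{n+1}{2}.$$ -/

import Mathlib

/-- A strict preference ordering over the objects `O`: a strongly connected, transitive and
antisymmetric relation. `R.weak x y` reads `x R y` (`x` is at least as good as `y`). -/
structure StrictPref (O : Type*) where
  weak : O → O → Prop
  total : ∀ x y, weak x y ∨ weak y x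
  trans : ∀ x y z, weak x y → weak y z → weak x z
  antisymm : ∀ x y, weak x y → weak y x → x = y

/-- `x P y`: `x` is strictly preferred to `y`. -/
def StrictPref.strict {O : Type*} (R : StrictPref O) (x y : O) : Prop :=
  ¬ R.weak y x

/-- Preference orderings carry the discrete σ-algebra. -/
instance StrictPref.instMeasurableSpace (O : Type*) : MeasurableSpace (StrictPref O) := ⊤

/-- A preference profile: one strict ordering of the objects for each agent, without restriction. -/
abbrev PrefProfile (N O : Type*) := N → StrictPref O

/-- An assignment: a bijection from the agents to the objects. -/
abbrev Assignment (N O : Type*) := N ≃ O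

/-- An assignment rule maps every preference profile to an assignment. -/
abbrev AssignmentRule (N O : Type*) := PrefProfile N O → Assignment N O

/-- The assignment `μ` is (Pareto) efficient at the profile `R`. -/
def Assignment.IsEfficientAt {N O : Type*} (μ : Assignment N O) (R : PrefProfile N O) : Prop :=
  ¬ ∃ ν : Assignment N O,
      (∀ i, (R i).weak (ν i) (μ i)) ∧ ∃ j, (R j).strict (ν j) (μ j)

/-- The rule selects an efficient assignment at every profile. -/
def AssignmentRule.IsEfficient {N O : Type*} (φ : AssignmentRule N O) : Prop :=
  ∀ R : PrefProfile N O, (φ R).IsEfficientAt R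

/-- No group `G` can manipulate: there is no profile `R` and no profile `R'` that agrees with `R`
outside `G`, so that `R' = (R'_G, R_{-G})`, such that all members of `G` weakly and some member of
`G` strictly prefers (according to `R`) the outcome at `R'` to the outcome at `R`. -/
def AssignmentRule.IsGroupStrategyProof {N O : Type*} (φ : AssignmentRule N O) : Prop :=
  ¬ ∃ (R : PrefProfile N O) (G : Set N) (R' : PrefProfile N O),
      (∀ i, i ∉ G → R' i = R i) ∧
      (∀ i ∈ G, (R i).weak (φ R' i) (φ R i)) ∧
      ∃ j ∈ G, (R j).strict (φ R' j) (φ R j)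

/-- The menu of agent `i`: the objects that `i` can obtain by varying the reported preference,
given the preferences `R_{-i}` of the others. The entry `R i` is overwritten, so the menu depends
on `R` only through `R_{-i}`. -/
def AssignmentRule.menu {N O : Type*} [DecidableEq N] (φ : AssignmentRule N O) (i : N)
    (R : PrefProfile N O) : Set O :=
  {x | ∃ Q : StrictPref O, φ (Function.update R i Q) i = x}

/-- The cardinal index of freedom of agent `i`: the number of objects in the menu of `i`. -/
noncomputable def AssignmentRule.freedom {N O : Type*} [DecidableEq N] (φ : AssignmentRule N O)
    (i : N) (R : PrefProfile N O) : ℕ :=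
  (φ.menu i R).ncard

/-!
Let `x = φ_i(R)` and `y = φ_j(R)` for two distinct agents `i` and `j`, and say that `i` *can reach*
`j` when `y` lies in the menu of `i`. As `φ R` is a bijection, the menu of `i` has as many elements
as there are agents `j` that `i` can reach, `i` itself included. It is therefore enough to show that,
over all profiles, an unordered pair of distinct agents contributes on average exactly one of the two
relations "`i` can reach `j`" and "`j` can reach `i`": the expected sum of the menu sizes is then
`n + n (n - 1) / 2`.

Equivalently, the profiles at which `i` and `j` can reach each other are as many as those at which
neither can reach the other. The bijection (`AssignmentRule.exchange`) exchanges the positions of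
`x` and `y` in the preferences of `i` and of `j`, and the assignment of these two agents is exchanged
with it, so that it is its own inverse.

Suppose first that `y` comes immediately after `x` in `R_i`, and `x` immediately after `y` in `R_j`.
By strategy-proofness and non-bossiness, exchanging an adjacent pair in the preference of one agent
changes nothing, unless this agent passes from the formerly better to the formerly worse object of
the pair (`eq_or_of_isAdjacent`). If the two agents can reach each other, then a change by `i` alone
gives `y` to `i`, and a change by `j` alone gives `x` to `j`; after either change the other agent
cannot pass between `x` and `y`, so that the outcome of both changes is the outcome of each one of
them. If neither can reach the other, no single change matters, but after both changes efficiency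
forces the exchange.

The general case follows because both the assignment and the relation "can reach" depend on the
preferences of the two agents only through the upper contour sets at the assigned objects
(`apply_update_of_upperEq`, `reaches_update_right_iff`), and hence `y` may be moved to the place
immediately after `x`.
-/

/-! ### Preference orderings -/

namespace StrictPref

variable {O : Type*}

@[ext]
theorem ext {Q Q' : StrictPref O} (h : ∀ u v, Q.weak u v ↔ Q'.weak u v) : Q = Q' := by
  cases Q; cases Q'
  simp only [StrictPref.mk.injEq]
  funext u v
  exact propext (h u v)

instance instFinite [Finite O] : Finite (StrictPref O) :=
  Finite.of_injective StrictPref.weak fun _ _ h =>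
    StrictPref.ext fun u v => iff_of_eq (congrFun (congrFun h u) v)

instance instDiscreteMeasurableSpace : DiscreteMeasurableSpace (StrictPref O) :=
  ⟨fun _ => trivial⟩

theorem refl (Q : StrictPref O) (u : O) : Q.weak u u := (Q.total u u).elim id id

theorem strict_of_weak_of_ne {Q : StrictPref O} {u v : O} (h : Q.weak u v) (hne : u ≠ v) :
    Q.strict u v := fun h' => hne (Q.antisymm u v h h')

/-- The ordering with the positions of `x` and `y` exchanged. -/
def exchange [DecidableEq O] (Q : StrictPref O) (x y : O) : StrictPref O where
  weak u v := Q.weak (Equiv.swap x y u) (Equiv.swap x y v)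
  total _ _ := Q.total _ _
  trans _ _ _ := Q.trans _ _ _
  antisymm _ _ h h' := (Equiv.swap x y).injective (Q.antisymm _ _ h h')

theorem exchange_weak [DecidableEq O] (Q : StrictPref O) (x y u v : O) :
    (Q.exchange x y).weak u v ↔ Q.weak (Equiv.swap x y u) (Equiv.swap x y v) := Iff.rfl

theorem exchange_comm [DecidableEq O] (Q : StrictPref O) (x y : O) :
    Q.exchange x y = Q.exchange y x := by
  ext u v
  rw [exchange_weak, exchange_weak, Equiv.swap_comm]

theorem exchange_exchange [DecidableEq O] (Q : StrictPref O) (x y : O) :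
    (Q.exchange x y).exchange x y = Q := by
  ext u v
  simp [exchange_weak]

/-- The ordering obtained by moving `y` to the place immediately after `x`. -/
def moveAfter [DecidableEq O] (Q : StrictPref O) (x y : O) : StrictPref O where
  weak u v :=
    if u = y then v = y ∨ ¬ Q.weak v x else if v = y then Q.weak u x else Q.weak u v
  total u v := by
    have := Q.total u v
    have := Q.refl u
    split_ifs <;> tauto
  trans u v w := by
    have := Q.trans
    have := Q.total
    split_ifs <;> grind
  antisymm u v := by
    have := Q.antisymm u v
    split_ifs <;> grind

/-- The orderings `Q` and `Q'` have the same upper contour set at `x`. -/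
def UpperEq (Q Q' : StrictPref O) (x : O) : Prop := ∀ z, Q.weak z x ↔ Q'.weak z x

/-- The object `y` comes immediately after `x`. -/
def IsAdjacent (Q : StrictPref O) (x y : O) : Prop :=
  x ≠ y ∧ Q.weak x y ∧ ∀ z, Q.weak z y → z = y ∨ Q.weak z x

theorem isAdjacent_moveAfter [DecidableEq O] (Q : StrictPref O) {x y : O} (hxy : x ≠ y) :
    (Q.moveAfter x y).IsAdjacent x y := by
  refine ⟨hxy, ?_, fun z => ?_⟩
  · simp [moveAfter, hxy, Q.refl]
  · by_cases h : z = y <;> simp [moveAfter, hxy, h]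

theorem upperEq_moveAfter [DecidableEq O] (Q : StrictPref O) {x y : O} (hxy : x ≠ y)
    (h : Q.weak x y) : Q.UpperEq (Q.moveAfter x y) x := by
  intro z
  by_cases hz : z = y
  · subst hz
    simpa [moveAfter, hxy, Q.refl] using fun h' => hxy (Q.antisymm _ _ h h')
  · simp [moveAfter, hxy, hz]

theorem UpperEq.symm {Q Q' : StrictPref O} {x : O} (h : Q.UpperEq Q' x) : Q'.UpperEq Q x :=
  fun z => (h z).symm

theorem UpperEq.exchange [DecidableEq O] {Q Q' : StrictPref O} {x : O} (h : Q.UpperEq Q' x)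
    (y : O) : (Q.exchange x y).UpperEq (Q'.exchange x y) y := by
  intro z
  simpa [exchange_weak] using h _

/-- Exchanging an adjacent pair affects no comparison other than that of the pair itself. -/
theorem IsAdjacent.weak_of_exchange [DecidableEq O] {Q : StrictPref O} {x y u v : O}
    (h : Q.IsAdjacent x y) (huv : (Q.exchange x y).weak u v) (hne : ¬ (u = y ∧ v = x)) :
    Q.weak u v := by
  obtain ⟨hxy, hw, had⟩ := h
  rw [exchange_weak] at huv
  have htrans := Q.trans
  have hrefl := Q.refl
  have htot := Q.total
  have hanti := Q.antisymm
  simp only [Equiv.swap_apply_def] at huv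
  split_ifs at huv <;> grind

end StrictPref

/-! ### Consequences of group-strategy-proofness -/

namespace AssignmentRule

open Function

variable {N O : Type*} [DecidableEq N] {φ : AssignmentRule N O}

theorem apply_update_mem_menu (φ : AssignmentRule N O) (i : N) (R : PrefProfile N O)
    (Q : StrictPref O) : φ (update R i Q) i ∈ φ.menu i R := ⟨Q, rfl⟩

theorem apply_mem_menu (φ : AssignmentRule N O) (i : N) (R : PrefProfile N O) :
    φ R i ∈ φ.menu i R := ⟨R i, by rw [update_eq_self]⟩

theorem menu_update (φ : AssignmentRule N O) (i : N) (R : PrefProfile N O) (Q : StrictPref O) :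
    φ.menu i (update R i Q) = φ.menu i R := by
  simp [menu]

/-- Strategy-proofness: every agent receives the best object in the own menu. -/
theorem weak_of_mem_menu (hφ : φ.IsGroupStrategyProof) {i : N} {R : PrefProfile N O} {z : O}
    (hz : z ∈ φ.menu i R) : (R i).weak (φ R i) z := by
  obtain ⟨Q, rfl⟩ := hz
  by_contra h
  refine hφ ⟨R, {i}, update R i Q, fun k hk => update_of_ne hk _ _, ?_, i, rfl, h⟩
  rintro k rfl
  exact ((R k).total _ _).resolve_left h

/-- Non-bossiness: an agent whose change of preference leaves the own object unchanged leaves the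
whole assignment unchanged. -/
theorem apply_update_eq (hφ : φ.IsGroupStrategyProof) {i : N} {R : PrefProfile N O}
    {Q : StrictPref O} (h : φ (update R i Q) i = φ R i) : φ (update R i Q) = φ R := by
  ext j
  by_cases hji : j = i
  · rw [hji, h]
  have hj : update R i Q j = R j := update_of_ne hji _ _
  have hout : ∀ k, k ∉ ({i, j} : Set N) → update R i Q k = R k := fun k hk =>
    update_of_ne (fun hki => hk (Or.inl hki)) _ _
  -- If `j` were better off at one of the two profiles, then `i` and `j` could move there jointly.
  refine (R j).antisymm _ _ ?_ ?_
  · by_contra hw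
    refine hφ ⟨update R i Q, {i, j}, R, fun k hk => (hout k hk).symm, ?_, j, Or.inr rfl, ?_⟩
    · rintro k (rfl | rfl)
      · rw [h]; exact StrictPref.refl _ _
      · rw [hj]; exact ((R k).total _ _).resolve_left hw
    · rwa [hj]
  · by_contra hw
    refine hφ ⟨R, {i, j}, update R i Q, hout, ?_, j, Or.inr rfl, hw⟩
    rintro k (rfl | rfl)
    · rw [h]; exact StrictPref.refl _ _
    · exact ((R k).total _ _).resolve_left hw

theorem apply_update_of_upperEq (hφ : φ.IsGroupStrategyProof) {i : N} {R : PrefProfile N O}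
    {Q : StrictPref O} (h : (R i).UpperEq Q (φ R i)) : φ (update R i Q) = φ R := by
  refine apply_update_eq hφ ((R i).antisymm _ _ ?_ ?_)
  · have := weak_of_mem_menu hφ (i := i) (R := update R i Q) (z := φ R i)
      (by rw [menu_update]; exact apply_mem_menu φ i R)
    rw [update_self] at this
    exact (h _).2 this
  · exact weak_of_mem_menu hφ (apply_update_mem_menu φ i R Q)

/-- An agent who exchanges an adjacent pair `x`, `y` either does not affect the assignment, or
passes from `x` to `y`. -/
theorem eq_or_of_isAdjacent [DecidableEq O] (hφ : φ.IsGroupStrategyProof) {i : N}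
    {R : PrefProfile N O} {x y : O} (h : (R i).IsAdjacent x y) :
    φ (update R i ((R i).exchange x y)) = φ R ∨
      (φ R i = x ∧ φ (update R i ((R i).exchange x y)) i = y) := by
  by_cases hc : φ R i = x ∧ φ (update R i ((R i).exchange x y)) i = y
  · exact Or.inr hc
  refine Or.inl (apply_update_eq hφ ((R i).antisymm _ _ ?_ ?_))
  · have := weak_of_mem_menu hφ (i := i) (R := update R i ((R i).exchange x y)) (z := φ R i)
      (by rw [menu_update]; exact apply_mem_menu φ i R)
    rw [update_self] at this
    exact h.weak_of_exchange this fun h' => hc ⟨h'.2, h'.1⟩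
  · exact weak_of_mem_menu hφ (apply_update_mem_menu φ i R _)

/-- If the agent receives the better object of an adjacent pair, then the exchange of the pair
leads to the other one precisely if that one is in the menu. -/
theorem apply_update_exchange_of_mem [DecidableEq O] (hφ : φ.IsGroupStrategyProof) {i : N}
    {R : PrefProfile N O} {x y : O} (h : (R i).IsAdjacent x y) (hy : y ∈ φ.menu i R) :
    φ R i = x → φ (update R i ((R i).exchange x y)) i = y := by
  intro hx
  rcases eq_or_of_isAdjacent hφ h with he | he
  · have := weak_of_mem_menu hφ (i := i) (R := update R i ((R i).exchange x y)) (z := y)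
      (by rwa [menu_update])
    rw [update_self, he, hx, StrictPref.exchange_weak, Equiv.swap_apply_left,
      Equiv.swap_apply_right] at this
    exact absurd ((R i).antisymm _ _ h.2.1 this) h.1
  · exact he.2

theorem apply_update_exchange_of_notMem [DecidableEq O] (hφ : φ.IsGroupStrategyProof) {i : N}
    {R : PrefProfile N O} {x y : O} (h : (R i).IsAdjacent x y) (hy : y ∉ φ.menu i R) :
    φ (update R i ((R i).exchange x y)) = φ R :=
  (eq_or_of_isAdjacent hφ h).resolve_right fun he =>
    hy (he.2 ▸ apply_update_mem_menu φ i R _)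

/-- Efficiency rules out that two agents prefer each other's objects. -/
theorem IsEfficient.not_envy (hφ : φ.IsEfficient) {R : PrefProfile N O} {i j : N} (hij : i ≠ j)
    (hi : (R i).weak (φ R j) (φ R i)) (hj : (R j).weak (φ R i) (φ R j)) : False := by
  refine hφ R ⟨(Equiv.swap i j).trans (φ R), fun k => ?_, i, ?_⟩
  · by_cases hki : k = i
    · subst hki; simpa using hi
    by_cases hkj : k = j
    · subst hkj; simpa using hj
    simpa [Equiv.swap_apply_of_ne_of_ne hki hkj] using (R k).refl _
  · simpa using StrictPref.strict_of_weak_of_ne hi fun h => hij ((φ R).injective h.symm)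

/-! ### Reachability between two agents -/

/-- Agent `i` can reach agent `j` at `R`: the object assigned to `j` is in the menu of `i`. -/
def Reaches (φ : AssignmentRule N O) (R : PrefProfile N O) (i j : N) : Prop :=
  φ R j ∈ φ.menu i R

theorem reaches_update_left_iff (hφ : φ.IsGroupStrategyProof) {i j : N} {R : PrefProfile N O}
    {Q : StrictPref O} (h : (R i).UpperEq Q (φ R i)) :
    φ.Reaches (update R i Q) i j ↔ φ.Reaches R i j := by
  rw [Reaches, Reaches, menu_update, apply_update_of_upperEq hφ h]

theorem Reaches.update_right [DecidableEq O] (hφ : φ.IsGroupStrategyProof) {i j : N} (hij : i ≠ j)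
    {R : PrefProfile N O} {Q : StrictPref O} (h : (R j).UpperEq Q (φ R j))
    (hr : φ.Reaches R i j) : φ.Reaches (update R j Q) i j := by
  have hne : φ R i ≠ φ R j := fun h' => hij ((φ R).injective h')
  -- It may be assumed that the object of `j` comes immediately after that of `i` in the
  -- preference of `i`.
  wlog had : (R i).IsAdjacent (φ R i) (φ R j) generalizing R
  · have hu := (R i).upperEq_moveAfter hne (weak_of_mem_menu hφ hr)
    have hφu := apply_update_of_upperEq hφ hu
    have := this (R := update R i ((R i).moveAfter (φ R i) (φ R j)))
      (by rw [hφu, update_of_ne hij.symm]; exact h) ((reaches_update_left_iff hφ hu).2 hr)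
      (by rwa [hφu]) (by rw [hφu, update_self]; exact StrictPref.isAdjacent_moveAfter _ hne)
    have hφj := apply_update_of_upperEq hφ h
    rw [update_comm hij] at this
    refine (reaches_update_left_iff hφ ?_).1 this
    rwa [hφj, update_of_ne hij]
  by_contra hnot
  have hφj := apply_update_of_upperEq hφ h
  rw [Reaches, hφj] at hnot
  -- The exchange by `i` is without effect after the change by `j`. Undoing the latter, it would be
  -- without effect at `R`.
  have h1 := apply_update_exchange_of_notMem hφ (i := i) (R := update R j Q)
    (by rw [update_of_ne hij]; exact had) hnot
  rw [update_of_ne hij, hφj] at h1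
  have h2 : φ (update (update (update R j Q) i ((R i).exchange (φ R i) (φ R j))) j (R j)) = φ R := by
    rw [apply_update_of_upperEq hφ, h1]
    rw [h1, update_of_ne hij.symm, update_self]
    exact h.symm
  have h3 := apply_update_exchange_of_mem hφ had hr rfl
  rw [update_comm hij.symm, update_idem, update_comm hij, update_eq_self] at h2
  exact hne (by rw [← h3, h2])

theorem reaches_update_right_iff [DecidableEq O] (hφ : φ.IsGroupStrategyProof) {i j : N}
    (hij : i ≠ j) {R : PrefProfile N O} {Q : StrictPref O} (h : (R j).UpperEq Q (φ R j)) :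
    φ.Reaches (update R j Q) i j ↔ φ.Reaches R i j := by
  refine ⟨fun hr => ?_, fun hr => hr.update_right hφ hij h⟩
  have := hr.update_right hφ hij (Q := R j)
    (by rw [apply_update_of_upperEq hφ h, update_self]; exact h.symm)
  rwa [update_idem, update_eq_self] at this

/-- If `j` cannot reach `i`, then `i` does not envy `j`. Otherwise `j` could move the object of `i` to
the place immediately before the own object, which leaves the assignment unchanged, but then the two
agents would prefer each other's objects. -/
theorem weak_of_not_reaches [DecidableEq O] (hφe : φ.IsEfficient) (hφ : φ.IsGroupStrategyProof)
    {i j : N} (hij : i ≠ j) {R : PrefProfile N O} (hr : ¬ φ.Reaches R j i) :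
    (R i).weak (φ R i) (φ R j) := by
  by_contra hw
  have hi := ((R i).total (φ R i) (φ R j)).resolve_left hw
  have hne : φ R j ≠ φ R i := fun h' => hij ((φ R).injective h'.symm)
  have hj : (R j).weak (φ R j) (φ R i) :=
    ((R j).total _ _).resolve_right fun hj => hφe.not_envy hij hi hj
  have hu := (R j).upperEq_moveAfter hne hj
  set Q := (R j).moveAfter (φ R j) (φ R i)
  have hφu := apply_update_of_upperEq hφ hu
  have h1 := apply_update_exchange_of_notMem hφ (i := j) (R := update R j Q) (x := φ R j)
    (y := φ R i) (by rw [update_self]; exact StrictPref.isAdjacent_moveAfter _ hne)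
    (by rwa [menu_update])
  rw [update_self, update_idem, hφu] at h1
  refine hφe.not_envy (R := update R j (Q.exchange (φ R j) (φ R i))) hij ?_ ?_
  · rwa [h1, update_of_ne hij]
  · rw [h1, update_self, StrictPref.exchange_weak, Equiv.swap_apply_left, Equiv.swap_apply_right]
    exact (StrictPref.isAdjacent_moveAfter _ hne).2.1

/-- Neither the assignment nor reachability between `i` and `j` changes when these two agents change
their preferences without changing the upper contour sets at their assigned objects. -/
theorem apply_eq_and_reaches_iff [DecidableEq O] (hφ : φ.IsGroupStrategyProof) {i j : N}
    (hij : i ≠ j) {R R' : PrefProfile N O} (hout : ∀ k, k ≠ i → k ≠ j → R' k = R k)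
    (hi : (R i).UpperEq (R' i) (φ R i)) (hj : (R j).UpperEq (R' j) (φ R j)) :
    φ R' = φ R ∧ (φ.Reaches R' i j ↔ φ.Reaches R i j) ∧
      (φ.Reaches R' j i ↔ φ.Reaches R j i) := by
  have hR' : R' = update (update R i (R' i)) j (R' j) := by
    funext k
    by_cases hkj : k = j
    · subst hkj; simp
    by_cases hki : k = i
    · subst hki; simp [hkj]
    simp [hkj, hki, hout k hki hkj]
  have h1 := apply_update_of_upperEq hφ hi
  have hj' : (update R i (R' i) j).UpperEq (R' j) (φ (update R i (R' i)) j) := by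
    rwa [h1, update_of_ne hij.symm]
  rw [hR', apply_update_of_upperEq hφ hj', reaches_update_right_iff hφ hij hj',
    reaches_update_left_iff hφ hi, reaches_update_left_iff hφ hj',
    reaches_update_right_iff hφ hij.symm hi]
  exact ⟨h1, Iff.rfl, Iff.rfl⟩

/-! ### Exchanging the objects of two agents -/

/-- The profile with the positions of the objects of `i` and `j` exchanged in the preferences of
these two agents. -/
def exchange [DecidableEq O] (φ : AssignmentRule N O) (i j : N) (R : PrefProfile N O) :
    PrefProfile N O :=
  update (update R i ((R i).exchange (φ R i) (φ R j))) j ((R j).exchange (φ R j) (φ R i))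

theorem exchange_comm [DecidableEq O] (φ : AssignmentRule N O) {i j : N} (hij : i ≠ j)
    (R : PrefProfile N O) : φ.exchange i j R = φ.exchange j i R := by
  rw [exchange, exchange, update_comm hij]

theorem exchange_left [DecidableEq O] (φ : AssignmentRule N O) {i j : N} (hij : i ≠ j)
    (R : PrefProfile N O) : φ.exchange i j R i = (R i).exchange (φ R i) (φ R j) := by
  simp [exchange, hij]

theorem exchange_right [DecidableEq O] (φ : AssignmentRule N O) (i j : N)
    (R : PrefProfile N O) : φ.exchange i j R j = (R j).exchange (φ R j) (φ R i) := by
  simp [exchange]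

theorem exchange_of_ne [DecidableEq O] (φ : AssignmentRule N O) {i j k : N} (hi : k ≠ i)
    (hj : k ≠ j) (R : PrefProfile N O) : φ.exchange i j R k = R k := by
  simp [exchange, hi, hj]

theorem exchange_exchange [DecidableEq O] {i j : N} (hij : i ≠ j) {R : PrefProfile N O}
    (hi : φ (φ.exchange i j R) i = φ R j) (hj : φ (φ.exchange i j R) j = φ R i) :
    φ.exchange i j (φ.exchange i j R) = R := by
  funext k
  by_cases hki : k = i
  · subst hki
    rw [exchange_left _ hij, hi, hj, exchange_left _ hij, StrictPref.exchange_comm,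
      StrictPref.exchange_exchange]
  by_cases hkj : k = j
  · subst hkj
    rw [exchange_right, hi, hj, exchange_right, StrictPref.exchange_comm,
      StrictPref.exchange_exchange]
  rw [exchange_of_ne _ hki hkj, exchange_of_ne _ hki hkj]

/-- After an exchange by `j` alone, the exchange by `i` makes no difference unless `i` still holds
the own former object. -/
theorem apply_exchange_eq_or [DecidableEq O] (hφ : φ.IsGroupStrategyProof) {i j : N} (hij : i ≠ j)
    {R : PrefProfile N O} (hadi : (R i).IsAdjacent (φ R i) (φ R j)) :
    φ (φ.exchange i j R) = φ (update R j ((R j).exchange (φ R j) (φ R i))) ∨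
      (φ (update R j ((R j).exchange (φ R j) (φ R i))) i = φ R i ∧
        φ (φ.exchange i j R) i = φ R j) := by
  have := eq_or_of_isAdjacent hφ (i := i) (R := update R j ((R j).exchange (φ R j) (φ R i)))
    (by rw [update_of_ne hij]; exact hadi)
  rwa [update_of_ne hij, update_comm hij.symm] at this

theorem apply_exchange_left_of_isAdjacent [DecidableEq O] (hφe : φ.IsEfficient)
    (hφ : φ.IsGroupStrategyProof) {i j : N} (hij : i ≠ j) {R : PrefProfile N O}
    (hadi : (R i).IsAdjacent (φ R i) (φ R j)) (hadj : (R j).IsAdjacent (φ R j) (φ R i))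
    (h : φ.Reaches R i j ↔ φ.Reaches R j i) : φ (φ.exchange i j R) i = φ R j := by
  have hi := apply_exchange_eq_or hφ hij hadi
  have hj := apply_exchange_eq_or hφ hij.symm hadj
  rw [← exchange_comm φ hij] at hj
  by_cases hr : φ.Reaches R i j
  · have h1 := apply_update_exchange_of_mem hφ hadi hr rfl
    rcases hj with hj | hj
    · rw [hj, h1]
    · exact absurd ((φ _).injective (h1.trans hj.1.symm)) hij
  · have h2 := apply_update_exchange_of_notMem hφ hadj (fun hr' => hr (h.2 hr'))
    rcases hi with hi | hi
    · rw [h2] at hi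
      refine (hφe.not_envy (R := φ.exchange i j R) hij ?_ ?_).elim
      · simpa [hi, exchange_left φ hij, StrictPref.exchange_weak] using hadi.2.1
      · simpa [hi, exchange_right, StrictPref.exchange_weak] using hadj.2.1
    · exact hi.2

theorem reaches_exchange_iff_of_isAdjacent [DecidableEq O] (hφe : φ.IsEfficient)
    (hφ : φ.IsGroupStrategyProof) {i j : N} (hij : i ≠ j) {R : PrefProfile N O}
    (hadi : (R i).IsAdjacent (φ R i) (φ R j)) (hadj : (R j).IsAdjacent (φ R j) (φ R i))
    (h : φ.Reaches R i j ↔ φ.Reaches R j i) :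
    φ.Reaches (φ.exchange i j R) i j ↔ ¬ φ.Reaches R i j := by
  have hi := apply_exchange_left_of_isAdjacent hφe hφ hij hadi hadj h
  have hj := apply_exchange_left_of_isAdjacent hφe hφ hij.symm hadj hadi h.symm
  rw [← exchange_comm φ hij] at hj
  have hmenu : φ.menu i (φ.exchange i j R) =
      φ.menu i (update R j ((R j).exchange (φ R j) (φ R i))) := by
    rw [exchange, update_comm hij, menu_update]
  rw [Reaches, hmenu, hj]
  by_cases hr : φ.Reaches R i j
  · simp only [hr, not_true_eq_false, iff_false]
    intro hx
    have h2 := apply_update_exchange_of_mem hφ hadj (h.1 hr) rfl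
    have hne : φ (update R j ((R j).exchange (φ R j) (φ R i))) i ≠ φ R i := fun h' =>
      hij ((φ _).injective (h'.trans h2.symm))
    have h12 := (apply_exchange_eq_or hφ hij hadi).resolve_right fun h' => hne h'.1
    have hw := weak_of_mem_menu hφ hx
    rw [← h12, hi, update_of_ne hij] at hw
    exact hadi.1 ((R i).antisymm _ _ hadi.2.1 hw)
  · simp only [hr, not_false_eq_true, iff_true]
    have h2 := apply_update_exchange_of_notMem hφ hadj (fun hr' => hr (h.2 hr'))
    have := apply_mem_menu φ i (update R j ((R j).exchange (φ R j) (φ R i)))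
    rwa [h2] at this

/-- If reachability between `i` and `j` is mutual or absent, then exchanging their objects in their
preferences exchanges these objects in the assignment, and turns mutual reachability into its absence
and vice versa. -/
theorem apply_exchange [DecidableEq O] (hφe : φ.IsEfficient)
    (hφ : φ.IsGroupStrategyProof) {i j : N} (hij : i ≠ j) {R : PrefProfile N O}
    (h : φ.Reaches R i j ↔ φ.Reaches R j i) :
    φ (φ.exchange i j R) i = φ R j ∧ φ (φ.exchange i j R) j = φ R i ∧
      (φ.Reaches (φ.exchange i j R) i j ↔ ¬ φ.Reaches R i j) ∧
      (φ.Reaches (φ.exchange i j R) j i ↔ ¬ φ.Reaches R j i) := by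
  have hne : φ R i ≠ φ R j := fun h' => hij ((φ R).injective h')
  have hwi : (R i).weak (φ R i) (φ R j) := by
    by_cases hr : φ.Reaches R i j
    · exact weak_of_mem_menu hφ hr
    · exact weak_of_not_reaches hφe hφ hij fun hr' => hr (h.2 hr')
  have hwj : (R j).weak (φ R j) (φ R i) := by
    by_cases hr : φ.Reaches R j i
    · exact weak_of_mem_menu hφ hr
    · exact weak_of_not_reaches hφe hφ hij.symm fun hr' => hr (h.1 hr')
  -- The profile `S` arises from `R` by making the two objects adjacent, with the object of `i` on
  -- top for `i` and that of `j` on top for `j`.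
  obtain ⟨S, hSi, hSj, hSout⟩ : ∃ S : PrefProfile N O, S i = (R i).moveAfter (φ R i) (φ R j) ∧
      S j = (R j).moveAfter (φ R j) (φ R i) ∧ ∀ k, k ≠ i → k ≠ j → S k = R k :=
    ⟨update (update R i ((R i).moveAfter (φ R i) (φ R j))) j ((R j).moveAfter (φ R j) (φ R i)),
      by simp [hij], by simp, fun k hki hkj => by simp [hki, hkj]⟩
  have hui : (R i).UpperEq (S i) (φ R i) := hSi ▸ (R i).upperEq_moveAfter hne hwi
  have huj : (R j).UpperEq (S j) (φ R j) := hSj ▸ (R j).upperEq_moveAfter hne.symm hwj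
  obtain ⟨hφS, hSij, hSji⟩ := apply_eq_and_reaches_iff hφ hij hSout hui huj
  have hadi : (S i).IsAdjacent (φ S i) (φ S j) := by
    rw [hφS, hSi]; exact StrictPref.isAdjacent_moveAfter _ hne
  have hadj : (S j).IsAdjacent (φ S j) (φ S i) := by
    rw [hφS, hSj]; exact StrictPref.isAdjacent_moveAfter _ hne.symm
  have hS : φ.Reaches S i j ↔ φ.Reaches S j i := by rw [hSij, hSji, h]
  have hi := apply_exchange_left_of_isAdjacent hφe hφ hij hadi hadj hS
  have hj := apply_exchange_left_of_isAdjacent hφe hφ hij.symm hadj hadi hS.symm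
  have hrij := reaches_exchange_iff_of_isAdjacent hφe hφ hij hadi hadj hS
  have hrji := reaches_exchange_iff_of_isAdjacent hφe hφ hij.symm hadj hadi hS.symm
  rw [← exchange_comm φ hij] at hj hrji
  -- The exchange commutes with the passage from `R` to `S` up to equality of upper contour sets.
  obtain ⟨hφR, hRij, hRji⟩ := apply_eq_and_reaches_iff hφ hij (R := φ.exchange i j S)
    (R' := φ.exchange i j R)
    (fun k hki hkj => by
      rw [exchange_of_ne φ hki hkj, exchange_of_ne φ hki hkj, hSout k hki hkj])
    (by rw [hi, exchange_left φ hij, exchange_left φ hij, hφS]; exact hui.symm.exchange _)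
    (by rw [hj, exchange_right, exchange_right, hφS]; exact huj.symm.exchange _)
  rw [hφR, hi, hj, hRij, hRji, hrij, hrji, hSij, hSji, hφS]
  exact ⟨rfl, rfl, Iff.rfl, Iff.rfl⟩

/-! ### Counting -/

open Classical in
/-- Over all profiles, two distinct agents contribute on average one reachability relation. -/
theorem sum_reaches_add_reaches [Fintype (PrefProfile N O)] (hφe : φ.IsEfficient)
    (hφ : φ.IsGroupStrategyProof) {i j : N} (hij : i ≠ j) :
    ∑ R : PrefProfile N O, ((if φ.Reaches R i j then (1 : ℝ) else 0) +
      (if φ.Reaches R j i then 1 else 0)) = Fintype.card (PrefProfile N O) := by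
  have hcard : (Finset.univ.filter fun R => φ.Reaches R i j ∧ φ.Reaches R j i).card =
      (Finset.univ.filter fun R => ¬ φ.Reaches R i j ∧ ¬ φ.Reaches R j i).card := by
    refine Finset.card_nbij' (φ.exchange i j) (φ.exchange i j) ?_ ?_ ?_ ?_
    · intro R hR
      simp only [Finset.coe_filter, Finset.mem_univ, true_and, Set.mem_ofPred_eq] at hR ⊢
      have := apply_exchange hφe hφ hij (R := R) (by tauto)
      tauto
    · intro R hR
      simp only [Finset.coe_filter, Finset.mem_univ, true_and, Set.mem_ofPred_eq] at hR ⊢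
      have := apply_exchange hφe hφ hij (R := R) (by tauto)
      tauto
    · intro R hR
      simp only [Finset.coe_filter, Finset.mem_univ, true_and, Set.mem_ofPred_eq] at hR
      have := apply_exchange hφe hφ hij (R := R) (by tauto)
      exact exchange_exchange hij this.1 this.2.1
    · intro R hR
      simp only [Finset.coe_filter, Finset.mem_univ, true_and, Set.mem_ofPred_eq] at hR
      have := apply_exchange hφe hφ hij (R := R) (by tauto)
      exact exchange_exchange hij this.1 this.2.1
  calc ∑ R : PrefProfile N O, ((if φ.Reaches R i j then (1 : ℝ) else 0) +
        (if φ.Reaches R j i then 1 else 0))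
      = ∑ R : PrefProfile N O, (1 + ((if φ.Reaches R i j ∧ φ.Reaches R j i then (1 : ℝ) else 0) -
        (if ¬ φ.Reaches R i j ∧ ¬ φ.Reaches R j i then 1 else 0))) := by
        refine Finset.sum_congr rfl fun R _ => ?_
        by_cases h1 : φ.Reaches R i j <;> by_cases h2 : φ.Reaches R j i <;> simp [h1, h2]
    _ = Fintype.card (PrefProfile N O) := by
        rw [Finset.sum_add_distrib, Finset.sum_sub_distrib, Finset.sum_boole, Finset.sum_boole,
          hcard]
        simp

open Classical in
theorem freedom_eq_sum [Fintype N] (φ : AssignmentRule N O) (i : N) (R : PrefProfile N O) :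
    (φ.freedom i R : ℝ) = ∑ j, if φ.Reaches R i j then (1 : ℝ) else 0 := by
  have hmenu : φ.menu i R = φ R '' {j | φ.Reaches R i j} := by
    ext x
    simp only [Set.mem_image, Set.mem_ofPred_eq, Reaches]
    refine ⟨fun hx => ⟨(φ R).symm x, by simpa using hx, by simp⟩, ?_⟩
    rintro ⟨j, hj, rfl⟩
    exact hj
  rw [Finset.sum_boole, freedom, hmenu, Set.ncard_image_of_injective _ (φ R).injective,
    Set.ncard_eq_toFinset_card', Set.toFinset_ofPred]

/-- The sum of all menu sizes over all profiles, doubled so that the double sum over the agents can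
be symmetrized. -/
theorem two_mul_sum_sum_freedom [Fintype N] [Fintype (PrefProfile N O)] (hφe : φ.IsEfficient)
    (hφ : φ.IsGroupStrategyProof) :
    2 * ∑ R : PrefProfile N O, ∑ i, (φ.freedom i R : ℝ) =
      Fintype.card (PrefProfile N O) * (Fintype.card N * (Fintype.card N + 1)) := by
  classical
  have hpair : ∀ i j : N, ∑ R : PrefProfile N O, ((if φ.Reaches R i j then (1 : ℝ) else 0) +
      (if φ.Reaches R j i then 1 else 0)) =
        Fintype.card (PrefProfile N O) * (1 + if i = j then 1 else 0) := by
    intro i j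
    by_cases hij : i = j
    · subst hij
      have : ∀ R, φ.Reaches R i i := fun R => apply_mem_menu φ i R
      simp only [this, if_true, Finset.sum_const, Finset.card_univ, nsmul_eq_mul]
    · simpa [hij] using sum_reaches_add_reaches hφe hφ hij
  calc 2 * ∑ R : PrefProfile N O, ∑ i, (φ.freedom i R : ℝ)
      = ∑ R : PrefProfile N O, ∑ i, ∑ j, ((if φ.Reaches R i j then (1 : ℝ) else 0) +
          (if φ.Reaches R j i then 1 else 0)) := by
        rw [Finset.mul_sum]
        refine Finset.sum_congr rfl fun R _ => ?_
        simp only [freedom_eq_sum, Finset.sum_add_distrib]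
        rw [Finset.sum_comm (f := fun i j => if φ.Reaches R j i then (1 : ℝ) else 0), two_mul]
    _ = ∑ i : N, ∑ j : N, (Fintype.card (PrefProfile N O) : ℝ) * (1 + if i = j then 1 else 0) := by
        rw [Finset.sum_comm]
        refine Finset.sum_congr rfl fun i _ => ?_
        rw [Finset.sum_comm]
        exact Finset.sum_congr rfl fun j _ => hpair i j
    _ = _ := by
        simp only [← Finset.mul_sum, Finset.sum_add_distrib, Finset.sum_const, Finset.card_univ,
          nsmul_eq_mul, Finset.sum_ite_eq, Finset.mem_univ, if_true]
        ring

end AssignmentRule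

/-! ### Uniformly distributed profiles -/

open MeasureTheory ProbabilityTheory in
/-- The expectation of a function of finitely many independent uniform variables with values in a
finite type is the mean over all their joint values. -/
theorem integral_comp_of_iIndepFun_uniformOn {ι α Ω : Type*} [Fintype ι] [Fintype α]
    [Fintype (ι → α)] [MeasurableSpace α] [DiscreteMeasurableSpace α] [MeasurableSpace Ω]
    {P : Measure Ω} [IsProbabilityMeasure P] {X : ι → Ω → α} (hX : ∀ i, Measurable (X i))
    (hind : iIndepFun X P) (hunif : ∀ i, P.map (X i) = uniformOn Set.univ) (f : (ι → α) → ℝ) :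
    ∫ ω, f (fun i => X i ω) ∂P = (Fintype.card (ι → α) : ℝ)⁻¹ * ∑ r, f r := by
  classical
  have hXm : Measurable fun ω i => X i ω := measurable_pi_lambda _ hX
  have hlaw := (iIndepFun_iff_map_fun_eq_pi_map fun i => (hX i).aemeasurable).1 hind
  have hprob : ∀ i, IsProbabilityMeasure (P.map (X i)) := fun i =>
    Measure.isProbabilityMeasure_map (hX i).aemeasurable
  have hfm : AEStronglyMeasurable f (P.map fun ω i => X i ω) :=
    (measurable_of_countable f).aestronglyMeasurable
  have : IsProbabilityMeasure (P.map fun ω i => X i ω) :=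
    Measure.isProbabilityMeasure_map hXm.aemeasurable
  rw [← integral_map (φ := fun ω i => X i ω) hXm.aemeasurable hfm,
    integral_fintype Integrable.of_finite, Finset.mul_sum]
  refine Finset.sum_congr rfl fun r _ => ?_
  have hr : (P.map fun ω i => X i ω).real {r} = (Fintype.card (ι → α) : ℝ)⁻¹ := by
    rw [hlaw, Measure.real, Measure.pi_singleton, ENNReal.toReal_prod]
    simp only [hunif, uniformOn_univ, Measure.count_singleton]
    have : Fintype.card (ι → α) = Fintype.card α ^ Fintype.card ι := by
      rw [← Nat.card_eq_fintype_card, Nat.card_fun, Nat.card_eq_fintype_card,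
        Nat.card_eq_fintype_card]
    simp [this]
  rw [hr, smul_eq_mul]

theorem mainTheorem8 {N O : Type*} [Fintype N] [DecidableEq N] [Fintype O]
    (n : ℕ) (hn : 1 ≤ n) (hN : Fintype.card N = n) (hO : Fintype.card O = n)
    (φ : AssignmentRule N O) (hφ_eff : φ.IsEfficient) (hφ_gsp : φ.IsGroupStrategyProof)
    {Ω : Type*} [MeasurableSpace Ω] (P : MeasureTheory.Measure Ω)
    [MeasureTheory.IsProbabilityMeasure P]
    (R : N → Ω → StrictPref O) (hR_meas : ∀ i, Measurable (R i))
    (hR_indep : ProbabilityTheory.iIndepFun R P)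
    (hR_unif : ∀ i, P.map (R i) = ProbabilityTheory.uniformOn (Set.univ : Set (StrictPref O))) :
    ∫ ω, (1 / (n : ℝ)) * ∑ i : N, (φ.freedom i (fun j => R j ω) : ℝ) ∂P = ((n : ℝ) + 1) / 2 := by
  have : Fintype (StrictPref O) := Fintype.ofFinite _
  have : Fintype (PrefProfile N O) := Fintype.ofFinite _
  obtain ⟨ω₀⟩ : Nonempty Ω := P.nonempty_of_neZero
  have : Nonempty (PrefProfile N O) := ⟨fun i => R i ω₀⟩
  rw [integral_comp_of_iIndepFun_uniformOn hR_meas hR_indep hR_unif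
    fun r => (1 / (n : ℝ)) * ∑ i : N, (φ.freedom i r : ℝ), ← Finset.mul_sum]
  have hsum := AssignmentRule.two_mul_sum_sum_freedom hφ_eff hφ_gsp
  rw [hN] at hsum
  have hcard : (Fintype.card (PrefProfile N O) : ℝ) ≠ 0 := by
    exact_mod_cast Fintype.card_ne_zero
  have hn0 : (n : ℝ) ≠ 0 := by exact_mod_cast (by omega : n ≠ 0)
  field_simp
  linarith
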